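/- A sequence $(a_n)_{n\in\omega}$ in a group $G$ is called a $T$-sequence if it converges to the neutral element in some non-discrete Hausdorff group topology on $G$; the topology determined by a $T$-sequence $(a_n)$ is the strongest group topology on $G$ in which $(a_n)$ converges to the neutral element, and a topological group is said to be determined by a $T$-sequence if its topology arises in this way from some $T$-sequence. For group topologies $\tau_1,\tau_2$ on $G$, $\tau_1\vee\tau_2$ denotes the weakest topology on $G$ for which both identity maps $(G,\tau_1\vee\tau_2)\to(G,\tau_i)$, $i=1,2$, are continuous. A topological group is complete if it is complete with respect to its two-sided uniformity (this is implied by completeness with respect to the left or the right uniformity). **Theorem 5.** (1) Let $\tau_1$ and $\tau_2$ be the group topologies on a countable group $G$ determined by $T$-sequences $(a_n)_{n\in\omega}$ and $(b_n)_{n\in\omega}$, respectively. If there is a non-identity element $g\in G$ such that for every $n_0\in\omega$ there exist $n,m\ge n_0$ with $g=a_n^{-1}b_m$, then the topological group $(G,\tau_1\vee\tau_2)$ is not complete, and it is not determined by a $T$-sequence. (2) Let $c$ be a non-zero integer. If $(a_n)$ and $(a_n+c)$ are both $T$-sequences in the group $\mathbb Z$ and $\tau_1,\tau_2$ are the topologies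 they determine, then $(\mathbb Z,\tau_1\vee\tau_2)$ is not complete and is not determined by a $T$-sequence. Moreover, there exists a sequence $(a_n)$ of integers such that $(a_n)$ and $(a_n+c)$ are both $T$-sequences in $\mathbb Z$; hence there are two group topologies on $\mathbb Z$ determined by $T$-sequences whose supremum is not complete and not determined by a $T$-sequence. -/

import Mathlib

open Filter Topology

namespace TSeq

universe u

variable {G : Type u} [Group G]

/-- The sequence `a` converges to the neutral element in the group topology `t`. -/
def ConvergesToOne (t : GroupTopology G) (a : ℕ → G) : Prop :=
  Tendsto a atTop (@nhds G t.toTopologicalSpace 1)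

/-- `a` is a `T`-sequence: it converges to the neutral element in some non-discrete Hausdorff
group topology. -/
def IsTSequence (a : ℕ → G) : Prop :=
  ∃ t : GroupTopology G, @T2Space G t.toTopologicalSpace ∧
    ¬ @DiscreteTopology G t.toTopologicalSpace ∧ ConvergesToOne t a

/-- The strongest group topology on `G` in which `a` converges to the neutral element.
In Mathlib's order on topologies `t ≤ s` means that `t` is stronger (finer) than `s`, so this is
an infimum; `isLeast_strongest` checks that it is attained. -/
def strongest (a : ℕ → G) : GroupTopology G :=
  sInf {t | ConvergesToOne t a}

theorem isLeast_strongest (a : ℕ → G) :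
    IsLeast {t : GroupTopology G | ConvergesToOne t a} (strongest a) := by
  refine ⟨?_, fun t ht => sInf_le ht⟩
  change Tendsto a atTop (@nhds G (strongest a).toTopologicalSpace 1)
  rw [strongest, GroupTopology.toTopologicalSpace_sInf, nhds_sInf]
  refine tendsto_iInf.2 fun s => tendsto_iInf.2 ?_
  rintro ⟨t, ht, rfl⟩
  exact ht

/-- The group `G` with the topology `t` is determined by some `T`-sequence. -/
def IsDetermined (t : GroupTopology G) : Prop :=
  ∃ a : ℕ → G, IsTSequence a ∧ t = strongest a

/-- The supremum `t₁ ∨ t₂` in the order by strength: the weakest topology for which both identity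
maps to `(G, t₁)` and `(G, t₂)` are continuous. It is Mathlib's `t₁ ⊓ t₂`, as Mathlib orders
topologies the other way round. -/
def join (t₁ t₂ : GroupTopology G) : GroupTopology G :=
  t₁ ⊓ t₂

/-- `G` with the topology `t` is complete with respect to its two-sided uniformity (the supremum,
in the order by strength, of the left and the right uniformities), that is, Raikov complete.
A group that is complete for its left or its right uniformity is complete in this sense. -/
def IsComplete (t : GroupTopology G) : Prop :=
  letI := t.toTopologicalSpace
  haveI := t.toIsTopologicalGroup
  @CompleteSpace G
    (IsTopologicalGroup.leftUniformSpace G ⊓ IsTopologicalGroup.rightUniformSpace G)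

end TSeq

/-!
On a countable group the strongest group topology in which `d` tends to `1` is Raikov complete.
Indeed, the words of length `n` in the terms of `d` and the first `n` elements of the group form an
increasing sequence of compact sets `K n` with `K m * K n ⊆ K (m + n)`; the topology coherent with
them is a group topology in which `d` still tends to `1`, so it is the strongest one. If a Cauchy
filter had no cluster point, it would contain closed sets `C i` disjoint from `K (2 * i)`, and
`⋃ i, (K i)⁻¹ * C i` would be a closed set, not containing `1`, that meets `A⁻¹ * A` for every
member `A` of the filter.

On the other hand, if `g = (a n)⁻¹ * b m` for arbitrarily large `n` and `m`, then a subsequence of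
`b` tends to `1` in one topology and to `g ≠ 1` in the other. It is Cauchy in the join and has no
limit there, so the join is not complete and, a fortiori, not determined by a `T`-sequence.

In `ℤ` one can choose `a n` divisible by `2 ^ n` with `a n + c` divisible by `3 ^ n`, so that the
two sequences tend to `0` in the `2`-adic and in the `3`-adic topology, respectively.
-/

namespace TSeq

open Set Pointwise Uniformity

section CoherentTopology

variable {X Y ι κ : Type*} [TopologicalSpace X] [TopologicalSpace Y]

theorem mem_nhdsSetWithin_iff_forall {s t u : Set X} : u ∈ 𝓝ˢ[t] s ↔ ∀ x ∈ s, u ∈ 𝓝[t] x := by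
  simp only [nhdsSetWithin, nhdsWithin, mem_inf_principal', mem_nhdsSet_iff_forall]

theorem exists_isCompact_mem_nhdsSetWithin_subset [R1Space X] {K A U : Set X} (hK : IsCompact K)
    (hA : IsCompact A) (hAK : A ⊆ K) (hU : U ∈ 𝓝ˢ[K] A) :
    ∃ C ∈ 𝓝ˢ[K] A, IsCompact C ∧ C ⊆ K ∧ C ⊆ U := by
  have : CompactSpace K := isCompact_iff_compactSpace.1 hK
  have hA' : IsCompact ((↑) ⁻¹' A : Set K) :=
    IsInducing.subtypeVal.isCompact_preimage' hA (by rwa [Subtype.range_coe])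
  have hmap : map (↑) (𝓝ˢ ((↑) ⁻¹' A : Set K)) = 𝓝ˢ[K] A := by
    rw [map_nhdsSet_subtype_val, Subtype.image_preimage_coe, inter_eq_right.2 hAK]
  rw [← hmap] at hU ⊢
  obtain ⟨C, ⟨hCA, hC⟩, hCU⟩ := hA'.nhdsSet_basis_isCompact.mem_iff.1 (mem_map.1 hU)
  exact ⟨(↑) '' C, image_mem_map hCA, hC.image continuous_subtype_val,
    Subtype.coe_image_subset K C, (image_subset_iff (f := Subtype.val)).2 hCU⟩

/-- The finest topology on `X` that induces on every `K i` a topology coarser than or equal to the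
given one. For an increasing sequence of compact sets it is the associated `k_ω`-topology. -/
@[reducible]
def coherentTopology (K : ι → Set X) : TopologicalSpace X :=
  ⨆ i, .coinduced ((↑) : K i → X) inferInstance

theorem isOpen_coherentTopology_iff {K : ι → Set X} {U : Set X} :
    IsOpen[coherentTopology K] U ↔ ∀ i, ∀ x ∈ U ∩ K i, U ∈ 𝓝[K i] x := by
  refine isOpen_iSup_iff.trans <| forall_congr' fun i => ?_
  rw [isOpen_coinduced, isOpen_iff_mem_nhds]
  simp only [Subtype.forall, mem_preimage, preimage_coe_mem_nhds_subtype, mem_inter_iff, and_imp]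
  exact forall_congr' fun x => forall_comm

theorem nhdsWithin_le_nhds_coherentTopology (K : ι → Set X) {i : ι} {x : X} (hx : x ∈ K i) :
    𝓝[K i] x ≤ @nhds X (coherentTopology K) x := by
  intro U hU
  obtain ⟨V, hVU, hV, hxV⟩ := (@mem_nhds_iff X (coherentTopology K) x U).1 hU
  exact mem_of_superset (isOpen_coherentTopology_iff.1 hV i x ⟨hxV, hx⟩) hVU

theorem continuous_coherentTopology {K : ι → Set X} {L : κ → Set Y} {f : X → Y}
    (hf : Continuous f) (hKL : ∀ i, ∃ j, MapsTo f (K i) (L j)) :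
    Continuous[coherentTopology K, coherentTopology L] f := by
  refine continuous_def.2 fun U hU => isOpen_coherentTopology_iff.2 fun i x hx => ?_
  obtain ⟨j, hj⟩ := hKL i
  exact hf.continuousWithinAt.tendsto_nhdsWithin hj
    (isOpen_coherentTopology_iff.1 hU j (f x) ⟨hx.1, hj hx.2⟩)

theorem isCoherentWith_range_of_le_coherentTopology {K : ι → Set X}
    (hK : ‹TopologicalSpace X› ≤ coherentTopology K) : IsCoherentWith (range K) where
  isOpen_of_forall_induced U hU := hK U <| isOpen_iSup_iff.2 fun i => hU (K i) (mem_range_self i)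

theorem isClosed_iUnion_of_forall_disjoint {K F : ℕ → Set X} (hcoh : IsCoherentWith (range K))
    (hK : Monotone K) (hF : ∀ i, IsClosed (F i)) (hFK : ∀ i, Disjoint (F i) (K i)) :
    IsClosed (⋃ i, F i) := by
  refine hcoh.isClosed_iff.2 (forall_mem_range.2 fun n => ?_)
  have htrace : ((↑) ⁻¹' ⋃ i, F i : Set (K n)) = (↑) ⁻¹' ⋃ i ∈ Iio n, F i := by
    ext x
    simp only [mem_preimage, mem_iUnion, mem_Iio, exists_prop]
    refine exists_congr fun i => (and_iff_right_of_imp fun hx => ?_).symm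
    by_contra! hni
    exact (hFK i).notMem_of_mem_left hx (hK hni x.2)
  rw [htrace]
  exact ((finite_Iio n).isClosed_biUnion fun i _ => hF i).preimage continuous_subtype_val

theorem isOpen_coherentTopology_iUnion {K A : ℕ → Set X} {N : ℕ} (hK : Monotone K)
    (hA : Monotone A) (hnhds : ∀ n, A (n + 1) ∈ 𝓝ˢ[K (N + n + 1)] (A n)) :
    IsOpen[coherentTopology K] (⋃ n, A n) := by
  rw [isOpen_coherentTopology_iff]
  rintro i x ⟨hx, -⟩
  obtain ⟨n, hn⟩ := mem_iUnion.1 hx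
  have hmem : A (max i n + 1) ∈ 𝓝[K (N + max i n + 1)] x :=
    mem_nhdsSetWithin_iff_forall.1 (hnhds _) x (hA (le_max_right i n) hn)
  exact mem_of_superset (nhdsWithin_mono x (hK (by lia)) hmem) (subset_iUnion A _)

/-- An increasing sequence of compact sets covering the space, as in the definition of a
`k_ω`-space. Unlike in `CompactExhaustion`, a member need not lie in the interior of the next. -/
structure IsCompactFiltration (K : ℕ → Set X) : Prop where
  isCompact (n : ℕ) : IsCompact (K n)
  monotone : Monotone K
  exists_mem (x : X) : ∃ n, x ∈ K n

variable {K : ℕ → Set X} {L : ℕ → Set Y} {W : Set (X × Y)}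

/-- A product of compact subsets of `K n` and `L n` that is contained in `W`. An open product inside
`W` is obtained as the union of a sequence of such boxes. -/
structure IsCompactBox (K : ℕ → Set X) (L : ℕ → Set Y) (W : Set (X × Y)) (n : ℕ)
    (P : Set X × Set Y) : Prop where
  isCompact_fst : IsCompact P.1
  isCompact_snd : IsCompact P.2
  fst_subset : P.1 ⊆ K n
  snd_subset : P.2 ⊆ L n
  prod_subset : P.1 ×ˢ P.2 ⊆ W

namespace IsCompactBox

variable [R1Space X] [R1Space Y]

theorem exists_succ (hK : IsCompactFiltration K) (hL : IsCompactFiltration L)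
    (hW : IsOpen[coherentTopology fun n => K n ×ˢ L n] W) {n : ℕ} {P : Set X × Set Y}
    (hP : IsCompactBox K L W n P) :
    ∃ Q, IsCompactBox K L W (n + 1) Q ∧ Q.1 ∈ 𝓝ˢ[K (n + 1)] P.1 ∧ Q.2 ∈ 𝓝ˢ[L (n + 1)] P.2 := by
  have hPK : P.1 ⊆ K (n + 1) := hP.fst_subset.trans (hK.monotone n.le_succ)
  have hPL : P.2 ⊆ L (n + 1) := hP.snd_subset.trans (hL.monotone n.le_succ)
  have hWP : W ∈ 𝓝ˢ[K (n + 1) ×ˢ L (n + 1)] (P.1 ×ˢ P.2) :=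
    mem_nhdsSetWithin_iff_forall.2 fun p hp => isOpen_coherentTopology_iff.1 hW (n + 1) p
      ⟨hP.prod_subset hp, prod_mono hPK hPL hp⟩
  obtain ⟨U, hU, V, hV, hUV⟩ := generalized_tube_lemma' hP.isCompact_fst hP.isCompact_snd hWP
  obtain ⟨A, hA, hAc, hAK, hAU⟩ := exists_isCompact_mem_nhdsSetWithin_subset
    (hK.isCompact _) hP.isCompact_fst hPK hU
  obtain ⟨B, hB, hBc, hBL, hBV⟩ := exists_isCompact_mem_nhdsSetWithin_subset
    (hL.isCompact _) hP.isCompact_snd hPL hV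
  exact ⟨(A, B), ⟨hAc, hBc, hAK, hBL, (prod_mono hAU hBV).trans hUV⟩, hA, hB⟩

theorem exists_seq (hK : IsCompactFiltration K) (hL : IsCompactFiltration L)
    (hW : IsOpen[coherentTopology fun n => K n ×ˢ L n] W) {N : ℕ} {P : Set X × Set Y}
    (hP : IsCompactBox K L W N P) :
    ∃ S : ℕ → Set X × Set Y, S 0 = P ∧ ∀ n, IsCompactBox K L W (N + n) (S n) ∧
      (S (n + 1)).1 ∈ 𝓝ˢ[K (N + n + 1)] (S n).1 ∧ (S (n + 1)).2 ∈ 𝓝ˢ[L (N + n + 1)] (S n).2 := by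
  choose! grow hbox hfst hsnd using fun n P => exists_succ (n := n) (P := P) hK hL hW
  let S : ℕ → Set X × Set Y := fun n => Nat.rec P (fun n Q => grow (N + n) Q) n
  have hS : ∀ n, IsCompactBox K L W (N + n) (S n) := fun n => by
    induction n with
    | zero => exact hP
    | succ n ih => exact hbox _ _ ih
  exact ⟨S, rfl, fun n => ⟨hS n, hfst _ _ (hS n), hsnd _ _ (hS n)⟩⟩

end IsCompactBox

theorem monotone_of_mem_nhdsSetWithin {K A : ℕ → Set X} (hAK : ∀ n, A n ⊆ K n)
    (hA : ∀ n, A (n + 1) ∈ 𝓝ˢ[K n] (A n)) : Monotone A :=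
  monotone_nat_of_le_succ fun n x hx =>
    mem_of_mem_nhdsWithin (hAK n hx) (mem_nhdsSetWithin_iff_forall.1 (hA n) x hx)

theorem exists_isOpen_coherentTopology_prod_subset [R1Space X] [R1Space Y]
    (hK : IsCompactFiltration K) (hL : IsCompactFiltration L)
    (hW : IsOpen[coherentTopology fun n => K n ×ˢ L n] W) {x : X} {y : Y} (hxy : (x, y) ∈ W) :
    ∃ U V, IsOpen[coherentTopology K] U ∧ IsOpen[coherentTopology L] V ∧ x ∈ U ∧ y ∈ V ∧
      U ×ˢ V ⊆ W := by
  obtain ⟨i, hx⟩ := hK.exists_mem x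
  obtain ⟨j, hy⟩ := hL.exists_mem y
  have hP : IsCompactBox K L W (max i j) ({x}, {y}) :=
    ⟨isCompact_singleton, isCompact_singleton,
      singleton_subset_iff.2 (hK.monotone (le_max_left i j) hx),
      singleton_subset_iff.2 (hL.monotone (le_max_right i j) hy), by simpa using hxy⟩
  obtain ⟨S, hS₀, hS⟩ := hP.exists_seq hK hL hW
  choose hbox hfst hsnd using hS
  have hmono₁ : Monotone fun n => (S n).1 :=
    monotone_of_mem_nhdsSetWithin (fun n => (hbox n).fst_subset) fun n =>
      nhdsSetWithin_mono_right (hK.monotone (Nat.le_succ _)) (hfst n)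
  have hmono₂ : Monotone fun n => (S n).2 :=
    monotone_of_mem_nhdsSetWithin (fun n => (hbox n).snd_subset) fun n =>
      nhdsSetWithin_mono_right (hL.monotone (Nat.le_succ _)) (hsnd n)
  refine ⟨_, _, isOpen_coherentTopology_iUnion hK.monotone hmono₁ hfst,
    isOpen_coherentTopology_iUnion hL.monotone hmono₂ hsnd, mem_iUnion.2 ⟨0, by simp [hS₀]⟩,
    mem_iUnion.2 ⟨0, by simp [hS₀]⟩, ?_⟩
  rw [prod_subset_iff]
  intro a ha b hb
  obtain ⟨m, hm⟩ := mem_iUnion.1 ha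
  obtain ⟨n, hn⟩ := mem_iUnion.1 hb
  exact (hbox (max m n)).prod_subset ⟨hmono₁ (le_max_left m n) hm, hmono₂ (le_max_right m n) hn⟩

theorem prod_coherentTopology [R1Space X] [R1Space Y] (hK : IsCompactFiltration K)
    (hL : IsCompactFiltration L) :
    @instTopologicalSpaceProd X Y (coherentTopology K) (coherentTopology L) =
      coherentTopology fun n => K n ×ˢ L n := by
  refine le_antisymm (TopologicalSpace.le_def.2 fun W hW => ?_) (le_inf ?_ ?_)
  · exact (@isOpen_prod_iff X Y (coherentTopology K) (coherentTopology L) W).2 fun _ _ =>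
      exists_isOpen_coherentTopology_prod_subset hK hL hW
  · exact continuous_iff_le_induced.1 <|
      continuous_coherentTopology continuous_fst fun n => ⟨n, fun _ hp => hp.1⟩
  · exact continuous_iff_le_induced.1 <|
      continuous_coherentTopology continuous_snd fun n => ⟨n, fun _ hp => hp.2⟩

end CoherentTopology

section CompactGroupFiltration

variable {H : Type*} [Group H] [TopologicalSpace H]

/-- A compact filtration of a group that is compatible with multiplication and inversion. This is
what makes the coherent topology a group topology. -/
structure IsCompactGroupFiltration (K : ℕ → Set H) : Prop extends IsCompactFiltration K where
  mul_subset (m n : ℕ) : K m * K n ⊆ K (m + n)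
  inv_subset (n : ℕ) : (K n)⁻¹ ⊆ K n

/-- The products of `n` factors, each of them an element of `S n` or the inverse of one. These sets
form a filtration of the group when `S` is an increasing cover. -/
def wordBall (S : ℕ → Set H) (n : ℕ) : Set H :=
  (S n ∪ (S n)⁻¹) ^ n

theorem isCompact_pow {M : Type*} [Monoid M] [TopologicalSpace M] [ContinuousMul M] {s : Set M}
    (hs : IsCompact s) (n : ℕ) : IsCompact (s ^ n) := by
  induction n with
  | zero => rw [pow_zero]; exact isCompact_singleton
  | succ n ih => rw [pow_succ]; exact ih.mul hs

variable [IsTopologicalGroup H]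

theorem isCompactGroupFiltration_wordBall {S : ℕ → Set H} (hcompact : ∀ n, IsCompact (S n))
    (hmono : Monotone S) (hone : ∀ n, 1 ∈ S n) (hcover : ∀ x, ∃ n, x ∈ S n) :
    IsCompactGroupFiltration (wordBall S) where
  isCompact n := isCompact_pow ((hcompact n).union (hcompact n).inv) n
  monotone m n hmn :=
    pow_subset_pow (union_subset_union (hmono hmn) (inv_subset_inv.2 (hmono hmn)))
      (Or.inl (hone n)) hmn
  exists_mem x := by
    obtain ⟨n, hx⟩ := hcover x
    exact ⟨n + 1, subset_pow (mem_union_left _ (hone _)) n.succ_ne_zero <|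
      mem_union_left _ (hmono n.le_succ hx)⟩
  mul_subset m n := by
    have hletters : Monotone fun k => S k ∪ (S k)⁻¹ := fun _ _ hkl =>
      union_subset_union (hmono hkl) (inv_subset_inv.2 (hmono hkl))
    rw [wordBall, wordBall, wordBall, pow_add]
    exact mul_subset_mul (pow_subset_pow_left (hletters (Nat.le_add_right m n)))
      (pow_subset_pow_left (hletters (Nat.le_add_left n m)))
  inv_subset n := by
    rw [wordBall, ← inv_pow, union_inv, inv_inv, union_comm]

theorem exists_isCompactGroupFiltration_insert_range_subset [Countable H] {d : ℕ → H}
    (hd : Tendsto d atTop (𝓝 1)) :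
    ∃ K n, IsCompactGroupFiltration K ∧ insert 1 (range d) ⊆ K n := by
  obtain ⟨e, he⟩ := exists_surjective_nat H
  let S : ℕ → Set H := fun n => insert 1 (range d) ∪ e '' Iic n
  have hcompact : ∀ n, IsCompact (S n) := fun n =>
    hd.isCompact_insert_range.union ((finite_Iic n).image e).isCompact
  have hmono : Monotone S := fun m n hmn =>
    union_subset_union_right _ (image_mono (Iic_subset_Iic.2 hmn))
  have hcover : ∀ x, ∃ n, x ∈ S n := fun x =>
    (he x).imp fun n hn => Or.inr ⟨n, self_mem_Iic, hn⟩
  refine ⟨wordBall S, 1, isCompactGroupFiltration_wordBall hcompact hmono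
    (fun n => Or.inl (mem_insert 1 _)) hcover, ?_⟩
  rw [wordBall, pow_one]
  exact subset_union_left.trans subset_union_left

namespace IsCompactGroupFiltration

variable {K : ℕ → Set H}

theorem isTopologicalGroup_coherentTopology (hK : IsCompactGroupFiltration K) :
    @IsTopologicalGroup H (coherentTopology K) _ := by
  have hmul : Continuous[@instTopologicalSpaceProd H H (coherentTopology K) (coherentTopology K),
      coherentTopology K] fun p : H × H => p.1 * p.2 := by
    rw [prod_coherentTopology hK.toIsCompactFiltration hK.toIsCompactFiltration]
    exact continuous_coherentTopology continuous_mul fun n =>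
      ⟨n + n, fun p hp => hK.mul_subset n n (mul_mem_mul hp.1 hp.2)⟩
  have hinv : Continuous[coherentTopology K, coherentTopology K] fun x : H => x⁻¹ :=
    continuous_coherentTopology continuous_inv fun n =>
      ⟨n, fun x hx => hK.inv_subset n (inv_mem_inv.2 hx)⟩
  let := coherentTopology K
  exact { continuous_mul := hmul, continuous_inv := hinv }

theorem completeSpace_leftUniformSpace (hK : IsCompactGroupFiltration K)
    (hcoh : IsCoherentWith (range K)) :
    @CompleteSpace H (IsTopologicalGroup.leftUniformSpace H) := by
  let := IsTopologicalGroup.leftUniformSpace H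
  refine ⟨fun {f} hf => ?_⟩
  have := hf.1
  by_contra! hlim
  have hdisj : ∀ n, Disjoint (𝓝ˢ (K n)) f := fun n =>
    (hK.isCompact n).disjoint_nhdsSet_left.2 fun x _ =>
      not_not.1 fun hx => hlim x (le_nhds_of_cauchy_adhp hf (neBot_iff.2 (hx ∘ disjoint_iff.2)))
  choose U hU hUf using fun n => (hasBasis_nhdsSet (K n)).disjoint_iff_left.1 (hdisj n)
  let F : ℕ → Set H := fun i => (K i)⁻¹ * (U (i + i))ᶜ
  have hF : ∀ i, IsClosed (F i) := fun i =>
    (hU _).1.isClosed_compl.mul_left_of_isCompact (hK.isCompact i).inv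
  have hFK : ∀ i, Disjoint (F i) (K i) := fun i => by
    rw [disjoint_left]
    rintro _ ⟨k, hk, c, hc, rfl⟩ hkc
    have hmem := hK.mul_subset i i (mul_mem_mul (mem_inv.1 hk) hkc)
    rw [inv_mul_cancel_left] at hmem
    exact hc ((hU _).2 hmem)
  have hone : (1 : H) ∉ ⋃ i, F i := by
    rw [mem_iUnion]
    rintro ⟨i, k, hk, c, hc, hkc⟩
    obtain rfl : k⁻¹ = c := (eq_inv_of_mul_eq_one_right hkc).symm
    exact hc ((hU _).2 (hK.monotone (Nat.le_add_left i i) (mem_inv.1 hk)))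
  have hnhds : (⋃ i, F i)ᶜ ∈ 𝓝 (1 : H) :=
    (isClosed_iUnion_of_forall_disjoint hcoh hK.monotone hF hFK).isOpen_compl.mem_nhds hone
  obtain ⟨A, hA, hAF⟩ := (cauchy_iff.1 hf).2 _ (preimage_mem_comap hnhds)
  obtain ⟨a, ha⟩ := Filter.nonempty_of_mem hA
  obtain ⟨i, hi⟩ := hK.exists_mem a
  obtain ⟨b, hb, hbU⟩ := Filter.nonempty_of_mem (inter_mem hA (hUf (i + i)))
  exact hAF (mk_mem_prod ha hb) (mem_iUnion.2 ⟨i, mul_mem_mul (inv_mem_inv.2 hi) hbU⟩)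

end IsCompactGroupFiltration

end CompactGroupFiltration

section GroupTopology

variable {H : Type*} [Group H]

/-- The two-sided uniformity of a group with a group topology, the one for which `IsComplete` asks
for completeness. -/
@[reducible]
def twoSidedUniformSpace (t : GroupTopology H) : UniformSpace H :=
  letI := t.toTopologicalSpace
  haveI := t.toIsTopologicalGroup
  IsTopologicalGroup.leftUniformSpace H ⊓ IsTopologicalGroup.rightUniformSpace H

theorem toTopologicalSpace_twoSidedUniformSpace (t : GroupTopology H) :
    (twoSidedUniformSpace t).toTopologicalSpace = t.toTopologicalSpace :=
  UniformSpace.toTopologicalSpace_inf.trans (inf_idem _)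

theorem uniformity_twoSidedUniformSpace (t : GroupTopology H) :
    𝓤[twoSidedUniformSpace t] =
      comap (fun p => p.1⁻¹ * p.2) (@nhds H t.toTopologicalSpace 1) ⊓
        comap (fun p => p.2 * p.1⁻¹) (@nhds H t.toTopologicalSpace 1) :=
  rfl

theorem nhds_join (t₁ t₂ : GroupTopology H) (x : H) :
    @nhds H (join t₁ t₂).toTopologicalSpace x =
      @nhds H t₁.toTopologicalSpace x ⊓ @nhds H t₂.toTopologicalSpace x :=
  nhds_inf

theorem twoSidedUniformSpace_join (t₁ t₂ : GroupTopology H) :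
    twoSidedUniformSpace (join t₁ t₂) = twoSidedUniformSpace t₁ ⊓ twoSidedUniformSpace t₂ := by
  refine UniformSpace.ext (Eq.trans ?_ inf_uniformity.symm)
  rw [uniformity_twoSidedUniformSpace (join t₁ t₂), nhds_join, comap_inf, comap_inf]
  exact inf_inf_inf_comm _ _ _ _

theorem isComplete_of_completeSpace_leftUniformSpace {t : GroupTopology H}
    (ht : @CompleteSpace H (@IsTopologicalGroup.leftUniformSpace H _ t.toTopologicalSpace
      t.toIsTopologicalGroup)) : IsComplete t := by
  refine @CompleteSpace.mk H (twoSidedUniformSpace t) fun {f} hf => ?_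
  obtain ⟨x, hx⟩ := ht.complete (hf.mono_uniformSpace inf_le_left)
  exact ⟨x, hx.trans_eq (by rw [toTopologicalSpace_twoSidedUniformSpace])⟩

theorem cauchy_twoSidedUniformSpace_of_le_nhds {t : GroupTopology H} {l : Filter H} [l.NeBot]
    {x : H} (hl : l ≤ @nhds H t.toTopologicalSpace x) : @Cauchy H (twoSidedUniformSpace t) l := by
  let := twoSidedUniformSpace t
  rw [← toTopologicalSpace_twoSidedUniformSpace t] at hl
  exact cauchy_nhds.mono hl

theorem not_isComplete_join {t₁ t₂ : GroupTopology H} (h₁ : @T2Space H t₁.toTopologicalSpace)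
    (h₂ : @T2Space H t₂.toTopologicalSpace) {l : Filter H} [l.NeBot] {x₁ x₂ : H} (hne : x₁ ≠ x₂)
    (hl₁ : l ≤ @nhds H t₁.toTopologicalSpace x₁) (hl₂ : l ≤ @nhds H t₂.toTopologicalSpace x₂) :
    ¬ IsComplete (join t₁ t₂) := by
  intro hcomplete
  have hcauchy : @Cauchy H (twoSidedUniformSpace (join t₁ t₂)) l := by
    rw [twoSidedUniformSpace_join]
    exact cauchy_inf_uniformSpace.2
      ⟨cauchy_twoSidedUniformSpace_of_le_nhds hl₁, cauchy_twoSidedUniformSpace_of_le_nhds hl₂⟩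
  obtain ⟨x, hx⟩ := hcomplete.complete hcauchy
  rw [toTopologicalSpace_twoSidedUniformSpace, nhds_join, le_inf_iff] at hx
  exact hne <| (@tendsto_nhds_unique H H t₁.toTopologicalSpace h₁ id l _ _ _ hl₁ hx.1).trans
    (@tendsto_nhds_unique H H t₂.toTopologicalSpace h₂ id l _ _ _ hx.2 hl₂)

theorem isComplete_strongest [Countable H] (d : ℕ → H) : IsComplete (strongest d) := by
  let := (strongest d).toTopologicalSpace
  have := (strongest d).toIsTopologicalGroup
  have hd : Tendsto d atTop (𝓝 1) := (isLeast_strongest d).1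
  obtain ⟨K, n, hK, hdK⟩ := exists_isCompactGroupFiltration_insert_range_subset hd
  have hdn : Tendsto d atTop (𝓝[K n] 1) :=
    tendsto_nhdsWithin_iff.2 ⟨hd, .of_forall fun k => hdK (Or.inr ⟨k, rfl⟩)⟩
  let s : GroupTopology H := ⟨coherentTopology K, hK.isTopologicalGroup_coherentTopology⟩
  have hs : ConvergesToOne s d :=
    hdn.mono_right (nhdsWithin_le_nhds_coherentTopology K (hdK (mem_insert 1 _)))
  have hle : strongest d ≤ s := (isLeast_strongest d).2 hs
  exact isComplete_of_completeSpace_leftUniformSpace <| hK.completeSpace_leftUniformSpace <|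
    isCoherentWith_range_of_le_coherentTopology (GroupTopology.toTopologicalSpace_le.2 hle)

theorem IsDetermined.isComplete [Countable H] {t : GroupTopology H} (ht : IsDetermined t) :
    IsComplete t := by
  obtain ⟨d, -, rfl⟩ := ht
  exact isComplete_strongest d

theorem not_isComplete_join_of_frequently_eq_inv_mul {t₁ t₂ : GroupTopology H}
    (h₁ : @T2Space H t₁.toTopologicalSpace) (h₂ : @T2Space H t₂.toTopologicalSpace) {a b : ℕ → H}
    (ha : ConvergesToOne t₁ a) (hb : ConvergesToOne t₂ b) {g : H} (hg : g ≠ 1)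
    (hab : ∀ n₀, ∃ n m, n₀ ≤ n ∧ n₀ ≤ m ∧ g = (a n)⁻¹ * b m) : ¬ IsComplete (join t₁ t₂) := by
  choose n m hn hm hgnm using hab
  have hbm₁ : Tendsto (b ∘ m) atTop (@nhds H t₁.toTopologicalSpace g) := by
    let := t₁.toTopologicalSpace
    have := t₁.toIsTopologicalGroup
    have han : Tendsto (a ∘ n) atTop (𝓝 1) := ha.comp (tendsto_atTop_mono hn tendsto_id)
    have hag : Tendsto (fun k => a (n k) * g) atTop (𝓝 g) := by simpa using han.mul_const g
    exact hag.congr fun k => by rw [hgnm k, mul_inv_cancel_left, Function.comp_apply]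
  have hbm₂ : Tendsto (b ∘ m) atTop (@nhds H t₂.toTopologicalSpace 1) :=
    hb.comp (tendsto_atTop_mono hm tendsto_id)
  exact not_isComplete_join h₁ h₂ hg hbm₁ hbm₂

theorem IsTSequence.t2Space_strongest {a : ℕ → H} (ha : IsTSequence a) :
    @T2Space H (strongest a).toTopologicalSpace := by
  obtain ⟨t, ht, -, hat⟩ := ha
  exact t2Space_antitone (GroupTopology.toTopologicalSpace_le.2 ((isLeast_strongest a).2 hat)) ht

end GroupTopology

section Integers

theorem IsTSequence.of_injective {H A : Type*} [Group H] [Group A] [TopologicalSpace A]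
    [IsTopologicalGroup A] [T2Space A] {φ : H →* A} (hφ : Function.Injective φ) {a b : ℕ → H}
    (ha : Tendsto (φ ∘ a) atTop (𝓝 1)) (hb : Tendsto (φ ∘ b) atTop (𝓝 1))
    (hb₁ : ∀ n, b n ≠ 1) : IsTSequence a := by
  let : TopologicalSpace H := .induced φ inferInstance
  have hφi : IsInducing φ := ⟨rfl⟩
  have hlim {c : ℕ → H} (hc : Tendsto (φ ∘ c) atTop (𝓝 1)) : Tendsto c atTop (𝓝 1) :=
    hφi.tendsto_nhds_iff.2 (by rwa [map_one])
  refine ⟨⟨_, topologicalGroup_induced φ⟩, .of_injective_continuous hφ hφi.continuous,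
    fun hdisc => ?_, hlim ha⟩
  have hbn : Tendsto b atTop (𝓝 1) := hlim hb
  rw [nhds_discrete H, tendsto_pure] at hbn
  obtain ⟨n, hn⟩ := hbn.exists
  exact hb₁ n hn

theorem tendsto_intCast_padicInt_zero {p : ℕ} [Fact p.Prime] {a : ℕ → ℤ}
    (ha : ∀ n, (p : ℤ) ^ n ∣ a n) : Tendsto (fun n => (a n : ℤ_[p])) atTop (𝓝 0) := by
  have hp : (p : ℝ)⁻¹ < 1 := inv_lt_one_of_one_lt₀ (mod_cast (Fact.out : p.Prime).one_lt)
  refine squeeze_zero_norm (fun n => ?_) (tendsto_pow_atTop_nhds_zero_of_lt_one (by positivity) hp)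
  simpa using (PadicInt.norm_int_le_pow_iff_dvd (k := a n) (n := n)).2 (mod_cast ha n)

theorem isTSequence_ofAdd_of_pow_dvd (p : ℕ) [Fact p.Prime] {a : ℕ → ℤ}
    (ha : ∀ n, (p : ℤ) ^ n ∣ a n) : IsTSequence fun n => Multiplicative.ofAdd (a n) :=
  .of_injective (φ := (Int.castAddHom ℤ_[p]).toMultiplicative)
    (b := fun n => Multiplicative.ofAdd ((p : ℤ) ^ n))
    (Int.cast_injective (α := ℤ_[p])) (tendsto_intCast_padicInt_zero ha)
    (tendsto_intCast_padicInt_zero fun _ => dvd_rfl)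
    fun n => pow_ne_zero (M₀ := ℤ) n (mod_cast (Fact.out : p.Prime).ne_zero)

theorem exists_isTSequence_add_const (c : ℤ) :
    ∃ a : ℕ → ℤ, IsTSequence (fun n => Multiplicative.ofAdd (a n)) ∧
      IsTSequence (fun n => Multiplicative.ofAdd (a n + c)) := by
  have hcop : ∀ n : ℕ, IsCoprime ((2 : ℤ) ^ n) (3 ^ n) := fun n => .pow (by norm_num)
  choose u v huv using hcop
  refine ⟨fun n => -c * u n * 2 ^ n, isTSequence_ofAdd_of_pow_dvd 2 fun n => dvd_mul_left _ _,
    isTSequence_ofAdd_of_pow_dvd 3 fun n => ⟨c * v n, ?_⟩⟩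
  push_cast
  linear_combination -c * huv n

end Integers

end TSeq

theorem theorem5_general :
    (∀ (G : Type*) [Group G] (t₁ t₂ : GroupTopology G) (a b : ℕ → G),
      @T2Space G t₁.toTopologicalSpace → @T2Space G t₂.toTopologicalSpace →
      TSeq.ConvergesToOne t₁ a → TSeq.ConvergesToOne t₂ b →
      (∃ g : G, g ≠ 1 ∧
        ∀ n₀ : ℕ, ∃ n m : ℕ, n₀ ≤ n ∧ n₀ ≤ m ∧ g = (a n)⁻¹ * b m) →
      ¬ TSeq.IsComplete (TSeq.join t₁ t₂) ∧
      (Countable G → ¬ TSeq.IsDetermined (TSeq.join t₁ t₂))) ∧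
    (∀ (c : ℤ), c ≠ 0 →
      (∀ (t₁ t₂ : GroupTopology (Multiplicative ℤ)) (a : ℕ → ℤ),
        @T2Space (Multiplicative ℤ) t₁.toTopologicalSpace →
        @T2Space (Multiplicative ℤ) t₂.toTopologicalSpace →
        TSeq.ConvergesToOne t₁ (fun n => Multiplicative.ofAdd (a n)) →
        TSeq.ConvergesToOne t₂ (fun n => Multiplicative.ofAdd (a n + c)) →
        ¬ TSeq.IsComplete (TSeq.join t₁ t₂) ∧ ¬ TSeq.IsDetermined (TSeq.join t₁ t₂)) ∧
      ∃ a : ℕ → ℤ,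
        TSeq.IsTSequence (fun n => Multiplicative.ofAdd (a n)) ∧
        TSeq.IsTSequence (fun n => Multiplicative.ofAdd (a n + c))) := by
  refine ⟨fun G _ t₁ t₂ a b h₁ h₂ ha hb ⟨g, hg, hab⟩ => ?_, fun c hc =>
    ⟨?_, TSeq.exists_isTSequence_add_const c⟩⟩
  · have hnot := TSeq.not_isComplete_join_of_frequently_eq_inv_mul h₁ h₂ ha hb hg hab
    exact ⟨hnot, fun _ hdet => hnot hdet.isComplete⟩
  · intro t₁ t₂ a h₁ h₂ ha hb
    have hnot := TSeq.not_isComplete_join_of_frequently_eq_inv_mul h₁ h₂ ha hb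
      (g := Multiplicative.ofAdd c) hc fun n =>
        ⟨n, n, le_rfl, le_rfl, by rw [ofAdd_add, inv_mul_cancel_left]⟩
    exact ⟨hnot, fun hdet => hnot hdet.isComplete⟩

theorem theorem5 :
    (∀ (G : Type*) [Group G] [Countable G] (a b : ℕ → G),
      TSeq.IsTSequence a → TSeq.IsTSequence b →
      (∃ g : G, g ≠ 1 ∧
        ∀ n₀ : ℕ, ∃ n m : ℕ, n₀ ≤ n ∧ n₀ ≤ m ∧ g = (a n)⁻¹ * b m) →
      ¬ TSeq.IsComplete (TSeq.join (TSeq.strongest a) (TSeq.strongest b)) ∧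
      ¬ TSeq.IsDetermined (TSeq.join (TSeq.strongest a) (TSeq.strongest b))) ∧
    (∀ (c : ℤ), c ≠ 0 →
      (∀ a : ℕ → ℤ,
        TSeq.IsTSequence (fun n => Multiplicative.ofAdd (a n)) →
        TSeq.IsTSequence (fun n => Multiplicative.ofAdd (a n + c)) →
        ¬ TSeq.IsComplete (TSeq.join
            (TSeq.strongest fun n => Multiplicative.ofAdd (a n))
            (TSeq.strongest fun n => Multiplicative.ofAdd (a n + c))) ∧
        ¬ TSeq.IsDetermined (TSeq.join
            (TSeq.strongest fun n => Multiplicative.ofAdd (a n))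
            (TSeq.strongest fun n => Multiplicative.ofAdd (a n + c)))) ∧
      ∃ a : ℕ → ℤ,
        TSeq.IsTSequence (fun n => Multiplicative.ofAdd (a n)) ∧
        TSeq.IsTSequence (fun n => Multiplicative.ofAdd (a n + c))) := by
  obtain ⟨h₁, h₂⟩ := theorem5_general
  exact ⟨fun G _ hG a b ha hb hab =>
      (h₁ G _ _ a b ha.t2Space_strongest hb.t2Space_strongest (TSeq.isLeast_strongest a).1
        (TSeq.isLeast_strongest b).1 hab).imp_right fun hdet => hdet hG,
    fun c hc => ⟨fun a ha hb =>
      (h₂ c hc).1 _ _ a ha.t2Space_strongest hb.t2Space_strongest (TSeq.isLeast_strongest _).1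
        (TSeq.isLeast_strongest _).1, (h₂ c hc).2⟩⟩
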